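/- For $g\ge 1$ let $\mathrm{Sp}(2g,\mathbb{Z})$ be the group of integral $2g\times 2g$ matrices $A$ with $AJA^{T}=J$, where $J=\begin{pmatrix}0&-I_g\\ I_g&0\end{pmatrix}$. An involution in a group is an element of order exactly $2$. If $g\ge 8$, then $\mathrm{Sp}(2g,\mathbb{Z})$ is generated by three (distinct) involutions; if $g\ge 3$, then $\mathrm{Sp}(2g,\mathbb{Z})$ is generated by four (distinct) involutions. -/

import Mathlib

open Matrix
set_option linter.unusedSimpArgs false

/-! The proof works with root elements of the symplectic group: the transvections `T v` and the
elements `S u v` for orthogonal `u`, `v`. A Euclidean algorithm on integral vectors shows that those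
attached to basis vectors generate everything (`HasRootElements.eq_top`).

Two of the involutions are dihedral reflections of the `g` hyperbolic pairs, conjugated by a block
matrix with powers of an order-six `f` in SL(2, ℤ). Their product `tw rot` rotates the pairs and
applies `f` at every index but `0`. The remaining involutions are built from a transposition and
from `κ i j`, which preserve the span of the `a i` and that of the `b i`; only the twist by `f`
mixes the two. Permutations and `κ` produce the linear elements `S (a i) (b j)`
(`S_a_b_mem_of_swap_mul_κ`), and the twist turns these into transvections (`T_mem_of_twist`).

With four involutions, the transposition and `κ` are separate generators. With three, they are
multiplied into one involution with disjoint supports; the commutator with a conjugate cancels the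
`κ` factors and leaves a 3-cycle. This gives the even permutations, which suffice. -/

namespace SymplecticInt

/-! ### The symplectic form, transvections and short root elements. -/

section Basis

variable {l : Type*} [DecidableEq l]

/-- The basis vector `a i`. -/
def a (i : l) : l ⊕ l → ℤ := Pi.single (.inl i) 1

/-- The basis vector `b i`, dual to `a i`. -/
def b (i : l) : l ⊕ l → ℤ := Pi.single (.inr i) 1

@[simp] theorem a_inl (i j : l) : a i (.inl j) = if i = j then 1 else 0 := by
  simp [a, Pi.single_apply, eq_comm]
@[simp] theorem a_inr (i j : l) : a i (.inr j) = 0 := by simp [a]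
@[simp] theorem b_inr (i j : l) : b i (.inr j) = if i = j then 1 else 0 := by
  simp [b, Pi.single_apply, eq_comm]
@[simp] theorem b_inl (i j : l) : b i (.inl j) = 0 := by simp [b]

end Basis

section Basic

variable {l : Type*} [Fintype l]

/-- The standard alternating form on `ℤ^(2g)`. -/
def form (x y : l ⊕ l → ℤ) : ℤ :=
  ∑ i, (x (.inl i) * y (.inr i) - x (.inr i) * y (.inl i))

theorem form_add_left (x y z : l ⊕ l → ℤ) : form (x + y) z = form x z + form y z := by
  simp only [form, ← Finset.sum_add_distrib]
  exact Finset.sum_congr rfl fun i _ => by simp; ring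

theorem form_swap (x y : l ⊕ l → ℤ) : form x y = -form y x := by
  simp only [form, ← Finset.sum_neg_distrib]
  exact Finset.sum_congr rfl fun i _ => by ring

theorem form_smul_left (n : ℤ) (x y : l ⊕ l → ℤ) : form (n • x) y = n * form x y := by
  simp only [form, Finset.mul_sum]
  exact Finset.sum_congr rfl fun i _ => by simp; ring

theorem form_add_right (x y z : l ⊕ l → ℤ) : form x (y + z) = form x y + form x z := by
  rw [form_swap, form_add_left, form_swap y, form_swap z]; ring

theorem form_smul_right (n : ℤ) (x y : l ⊕ l → ℤ) : form x (n • y) = n * form x y := by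
  rw [form_swap, form_smul_left, form_swap y]; ring

theorem form_neg_left (x y : l ⊕ l → ℤ) : form (-x) y = -form x y := by
  simpa using form_smul_left (-1) x y

theorem form_neg_right (x y : l ⊕ l → ℤ) : form x (-y) = -form x y := by
  simpa using form_smul_right (-1) x y

theorem form_sub_left (x y z : l ⊕ l → ℤ) : form (x - y) z = form x z - form y z := by
  rw [sub_eq_add_neg, form_add_left, form_neg_left, sub_eq_add_neg]

theorem form_sub_right (x y z : l ⊕ l → ℤ) : form x (y - z) = form x y - form x z := by
  rw [sub_eq_add_neg, form_add_right, form_neg_right, sub_eq_add_neg]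

@[simp] theorem form_self (x : l ⊕ l → ℤ) : form x x = 0 := by
  have := form_swap x x; lia

variable [DecidableEq l]

theorem dotProduct_J_mulVec (x y : l ⊕ l → ℤ) : x ⬝ᵥ (J l ℤ *ᵥ y) = -form x y := by
  have h : J l ℤ *ᵥ y = Sum.elim (fun i => -y (.inr i)) (fun i => y (.inl i)) := by
    rw [J, fromBlocks_mulVec]
    ext (i | i) <;> simp [neg_mulVec]
  rw [h, dotProduct, Fintype.sum_sum_type, form, ← Finset.sum_neg_distrib,
    ← Finset.sum_add_distrib]
  exact Finset.sum_congr rfl fun i _ => by simp; ring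

@[simp] theorem form_smul_smul (M : symplecticGroup l ℤ) (x y : l ⊕ l → ℤ) :
    form (M • x) (M • y) = form x y := by
  have h := SymplecticGroup.mem_iff'.1 M.2
  have := dotProduct_J_mulVec (M • x) (M • y)
  change (M.1 *ᵥ x) ⬝ᵥ (J l ℤ *ᵥ (M.1 *ᵥ y)) = _ at this
  rw [mulVec_mulVec, dotProduct_mulVec, vecMul_mulVec, ← dotProduct_mulVec, ← mul_assoc, h,
    dotProduct_J_mulVec] at this
  lia

theorem form_smul_left_inv (M : symplecticGroup l ℤ) (x y : l ⊕ l → ℤ) :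
    form (M • x) y = form x (M⁻¹ • y) := by
  rw [← form_smul_smul M x, smul_inv_smul]

theorem ext_smul {M N : symplecticGroup l ℤ} (h : ∀ x : l ⊕ l → ℤ, M • x = N • x) : M = N := by
  apply Subtype.ext
  apply Matrix.toLin'.injective
  exact LinearMap.ext fun x => h x

/-- A form-preserving endomorphism of `ℤ^(2g)` as a symplectic matrix. -/
def ofEnd (F : (l ⊕ l → ℤ) →ₗ[ℤ] (l ⊕ l → ℤ)) (hF : ∀ x y, form (F x) (F y) = form x y) :
    symplecticGroup l ℤ :=
  ⟨LinearMap.toMatrix' F, by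
    rw [SymplecticGroup.mem_iff']
    have h (x y : l ⊕ l → ℤ) : x ⬝ᵥ (((LinearMap.toMatrix' F)ᵀ * J l ℤ * LinearMap.toMatrix' F) *ᵥ y)
        = x ⬝ᵥ (J l ℤ *ᵥ y) := by
      rw [dotProduct_J_mulVec, ← hF, ← dotProduct_J_mulVec, ← LinearMap.toMatrix'_mulVec,
        ← LinearMap.toMatrix'_mulVec F, mulVec_mulVec, dotProduct_mulVec (_ *ᵥ _), vecMul_mulVec,
        ← dotProduct_mulVec, ← mul_assoc]
    ext i j
    simpa using h (Pi.single i 1) (Pi.single j 1)⟩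

@[simp] theorem ofEnd_smul (F : (l ⊕ l → ℤ) →ₗ[ℤ] (l ⊕ l → ℤ)) (hF) (x : l ⊕ l → ℤ) :
    ofEnd F hF • x = F x :=
  LinearMap.toMatrix'_mulVec F x

@[simp] theorem form_a (i : l) (x : l ⊕ l → ℤ) : form (a i) x = x (.inr i) := by
  rw [form, Finset.sum_eq_single i] <;> simp +contextual [a]

@[simp] theorem form_b (i : l) (x : l ⊕ l → ℤ) : form (b i) x = -x (.inl i) := by
  rw [form, Finset.sum_eq_single i] <;> simp +contextual [b]

@[simp] theorem form_right_a (i : l) (x : l ⊕ l → ℤ) : form x (a i) = -x (.inr i) := by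
  rw [form_swap, form_a]

@[simp] theorem form_right_b (i : l) (x : l ⊕ l → ℤ) : form x (b i) = x (.inl i) := by
  rw [form_swap, form_b, neg_neg]

/-- The transvection `x ↦ x + ω(v, x) v`. -/
def T (v : l ⊕ l → ℤ) : symplecticGroup l ℤ :=
  ofEnd
    { toFun := fun x => x + form v x • v
      map_add' := fun x y => by rw [form_add_right]; module
      map_smul' := fun n x => by simp only [form_smul_right, RingHom.id_apply]; module }
    fun x y => by
      simp only [LinearMap.coe_mk, AddHom.coe_mk, form_add_left, form_add_right, form_smul_left,
        form_smul_right, form_self]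
      rw [form_swap x v]; ring

@[simp] theorem T_smul (v x : l ⊕ l → ℤ) : T v • x = x + form v x • v :=
  ofEnd_smul ..

@[simp] theorem T_inv_smul (v x : l ⊕ l → ℤ) : (T v)⁻¹ • x = x - form v x • v := by
  rw [inv_smul_eq_iff, T_smul, form_sub_right, form_smul_right, form_self]
  module

theorem T_zpow_smul (v x : l ⊕ l → ℤ) (n : ℤ) : (T v ^ n) • x = x + (n * form v x) • v := by
  induction n generalizing x with
  | zero => simp
  | succ n ih =>
    rw [_root_.zpow_add_one, mul_smul, T_smul, ih, form_add_right, form_smul_right, form_self]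
    module
  | pred n ih =>
    rw [_root_.zpow_sub_one, mul_smul, T_inv_smul, ih, form_sub_right, form_smul_right, form_self]
    module

theorem T_neg (v : l ⊕ l → ℤ) : T (-v) = T v :=
  ext_smul fun x => by simp only [T_smul, form_neg_left]; module

theorem conj_T (M : symplecticGroup l ℤ) (v : l ⊕ l → ℤ) : M * T v * M⁻¹ = T (M • v) :=
  ext_smul fun x => by
    rw [mul_smul, mul_smul, T_smul, T_smul, smul_add, smul_inv_smul, smul_comm,
      form_smul_left_inv]

/-- For orthogonal `u` and `v`, the map `x ↦ x + ω(u, x) v + ω(v, x) u`. -/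
def S (u v : l ⊕ l → ℤ) : symplecticGroup l ℤ := T (u + v) * (T u)⁻¹ * (T v)⁻¹

theorem conj_S (M : symplecticGroup l ℤ) (u v : l ⊕ l → ℤ) :
    M * S u v * M⁻¹ = S (M • u) (M • v) := by
  simp only [S, ← smul_add, ← conj_T]; group

variable {u v : l ⊕ l → ℤ}

theorem S_smul (h : form u v = 0) (x : l ⊕ l → ℤ) :
    S u v • x = x + form u x • v + form v x • u := by
  simp only [S, mul_smul, T_inv_smul, T_smul, form_add_left, form_sub_right, form_smul_right,
    form_self, h, form_swap v u]
  module

theorem S_comm (h : form u v = 0) : S u v = S v u :=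
  ext_smul fun x => by
    rw [S_smul h, S_smul (by rw [form_swap, h, neg_zero])]; abel

theorem S_inv (h : form u v = 0) : (S u v)⁻¹ = S u (-v) := by
  rw [inv_eq_iff_mul_eq_one]
  refine ext_smul fun x => ?_
  rw [mul_smul, S_smul h, S_smul (by rw [form_neg_right, h, neg_zero]), one_smul]
  simp only [form_neg_left, form_neg_right, form_add_right, form_smul_right, form_self, h,
    form_swap v u]
  module

/-- The Heisenberg relation: `S z` is additive on the orthogonal complement of `z` up to powers of
`T z`. It serves both to add vectors and to extract `T z` from short root elements. -/
theorem S_mul_S {z x y : l ⊕ l → ℤ} (hx : form z x = 0) (hy : form z y = 0) :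
    S z x * S z y = S z (x + y) * T z ^ form x y :=
  ext_smul fun w => by
    rw [mul_smul, mul_smul, S_smul hx, S_smul hy, S_smul (by rw [form_add_right, hx, hy]; rfl),
      T_zpow_smul]
    simp only [form_add_left, form_add_right, form_smul_right, form_self, hx, hy, form_swap x z,
      form_swap y z]
    module

end Basic

/-! ### Generation by elementary root elements. -/

section Generation

variable {g : ℕ}

/-- The standard basis of `ℤ^(2g)`. -/
def e (α : Fin g ⊕ Fin g) : Fin g ⊕ Fin g → ℤ := Pi.single α 1

/-- The index of the hyperbolic pair that a basis vector belongs to. -/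
def idx : Fin g ⊕ Fin g → Fin g := Sum.elim id id

@[simp] theorem idx_swap (α : Fin g ⊕ Fin g) : idx α.swap = idx α := by
  cases α <;> rfl

theorem swap_ne (α : Fin g ⊕ Fin g) : α.swap ≠ α := by
  cases α <;> simp

theorem e_apply (α β : Fin g ⊕ Fin g) : e α β = if β = α then 1 else 0 := by
  simp [e, Pi.single_apply]

theorem exists_sign_form_e (α : Fin g ⊕ Fin g) :
    ∃ s : ℤ, (s = 1 ∨ s = -1) ∧ ∀ x, form (e α) x = s * x α.swap := by
  rcases α with i | i
  · exact ⟨1, by simp, fun x => by rw [one_mul]; exact form_a i x⟩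
  · exact ⟨-1, by simp, fun x => by rw [neg_one_mul]; exact form_b i x⟩

theorem form_e_e {α β : Fin g ⊕ Fin g} (h : β ≠ α.swap) : form (e α) (e β) = 0 := by
  obtain ⟨s, -, hs⟩ := exists_sign_form_e α
  rw [hs, e_apply, if_neg h.symm, mul_zero]

/-- The elements of `H` that fix the first `k` hyperbolic pairs. -/
def lowerFix (H : Subgroup (symplecticGroup (Fin g) ℤ)) (k : ℕ) :
    Subgroup (symplecticGroup (Fin g) ℤ) :=
  H ⊓ fixingSubgroup _ {x | ∃ α : Fin g ⊕ Fin g, (idx α : ℕ) < k ∧ x = e α}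

theorem mem_lowerFix {H : Subgroup (symplecticGroup (Fin g) ℤ)} {k : ℕ}
    {M : symplecticGroup (Fin g) ℤ} :
    M ∈ lowerFix H k ↔ M ∈ H ∧ ∀ α : Fin g ⊕ Fin g, (idx α : ℕ) < k → M • e α = e α := by
  simp only [lowerFix, Subgroup.mem_inf, mem_fixingSubgroup_iff, Set.mem_ofPred_eq]
  grind

/-- `H` contains the elementary transvections and the short root elements. -/
structure HasRootElements (H : Subgroup (symplecticGroup (Fin g) ℤ)) : Prop where
  long : ∀ α, T (e α) ∈ H
  short : ∀ α β, β ≠ α → β ≠ α.swap → S (e α) (e β) ∈ H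

variable {H : Subgroup (symplecticGroup (Fin g) ℤ)} {k : ℕ}

theorem T_mem_lowerFix {v : Fin g ⊕ Fin g → ℤ} (h : T v ∈ H)
    (hv : ∀ α, (idx α : ℕ) < k → v α = 0) : T v ∈ lowerFix H k := by
  refine mem_lowerFix.2 ⟨h, fun α hα => ?_⟩
  obtain ⟨s, -, hs⟩ := exists_sign_form_e α
  rw [T_smul, form_swap, hs, hv _ (by simpa using hα)]
  simp

theorem S_mem_lowerFix {u v : Fin g ⊕ Fin g → ℤ} (huv : form u v = 0) (h : S u v ∈ H)
    (hu : ∀ α, (idx α : ℕ) < k → u α = 0) (hv : ∀ α, (idx α : ℕ) < k → v α = 0) :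
    S u v ∈ lowerFix H k := by
  refine mem_lowerFix.2 ⟨h, fun α hα => ?_⟩
  obtain ⟨s, -, hs⟩ := exists_sign_form_e α
  rw [S_smul huv, form_swap, hs, form_swap v, hs, hv _ (by simpa using hα),
    hu _ (by simpa using hα)]
  simp

theorem e_apply_of_lt {α β : Fin g ⊕ Fin g} (hβ : k ≤ idx β) (hα : (idx α : ℕ) < k) :
    e β α = 0 := by
  rw [e_apply, if_neg]; rintro rfl; lia

/-- A row operation. A short root element also alters coordinate `γ.swap`, by a multiple of `w
β.swap`; the side condition makes this vanish, and it is not needed when a transvection does the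
job. -/
theorem HasRootElements.exists_move_aux (hH : HasRootElements H) {β γ : Fin g ⊕ Fin g}
    (hβ : k ≤ idx β) (hγ : k ≤ idx γ) (hne : β ≠ γ) :
    ∃ h ∈ lowerFix H k, ∃ s : ℤ, (s = 1 ∨ s = -1) ∧ ∀ w : Fin g ⊕ Fin g → ℤ,
      (γ = β.swap ∨ w β.swap = 0) → h • w = w + (s * w γ) • e β := by
  by_cases hs : γ = β.swap
  · obtain ⟨s, h1, h2⟩ := exists_sign_form_e β
    refine ⟨T (e β), T_mem_lowerFix (hH.long β) fun α => e_apply_of_lt hβ, s, h1, fun w _ => ?_⟩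
    rw [T_smul, h2, hs]
  · obtain ⟨s, h1, h2⟩ := exists_sign_form_e γ.swap
    obtain ⟨t, -, h4⟩ := exists_sign_form_e β
    have h0 : form (e γ.swap) (e β) = 0 := form_e_e (by simpa using hne)
    refine ⟨S (e γ.swap) (e β), S_mem_lowerFix h0 (hH.short _ _ ?_ (by simpa using hne))
      (fun α => e_apply_of_lt (by simpa using hγ)) (fun α => e_apply_of_lt hβ), s, h1,
      fun w hw => ?_⟩
    · rintro rfl; simp at hs
    · rw [S_smul h0, h2, h4, hw.resolve_left hs]; simp

theorem HasRootElements.exists_move (hH : HasRootElements H) {β γ : Fin g ⊕ Fin g}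
    (hβ : k ≤ idx β) (hγ : k ≤ idx γ) (hne : β ≠ γ) (w : Fin g ⊕ Fin g → ℤ)
    (hw : γ = β.swap ∨ w β.swap = 0) {n : ℤ} (hn : n = 1 ∨ n = -1) :
    ∃ h ∈ lowerFix H k, h • w = w + (n * w γ) • e β := by
  obtain ⟨h, hh, s, hs, H1⟩ := hH.exists_move_aux hβ hγ hne
  by_cases hns : n = s
  · exact ⟨h, hh, hns ▸ H1 w hw⟩
  · obtain rfl : n = -s := by lia
    refine ⟨h⁻¹, inv_mem hh, ?_⟩
    rw [inv_smul_eq_iff, H1]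
    · simp [e_apply, hne.symm]
    · simpa [e_apply, swap_ne] using hw

theorem HasRootElements.exists_smul_eq_of_ne (hH : HasRootElements H) {κ β : Fin g ⊕ Fin g}
    (hκ : k ≤ idx κ) (hβ : k ≤ idx β) (hne : β ≠ κ) {c : ℤ} (hc : c = 1 ∨ c = -1) :
    ∃ h ∈ lowerFix H k, h • c • e β = e κ := by
  have hcc : c * c = 1 := by rcases hc with rfl | rfl <;> rfl
  obtain ⟨h₁, m₁, e₁⟩ := hH.exists_move hκ hβ hne.symm (c • e β)
    (or_iff_not_imp_left.2 fun h => by simp [e_apply, Ne.symm h]) hc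
  obtain ⟨h₂, m₂, e₂⟩ := hH.exists_move hβ hκ hne (c • e β + e κ)
    (by
      by_cases h : κ = β.swap
      · simp [h]
      · simp [e_apply, swap_ne, Ne.symm h]) (n := -c) (by lia)
  refine ⟨h₂ * h₁, mul_mem m₂ m₁, ?_⟩
  have h3 : (c * (c • e β) β) • e κ = e κ := by simp [e_apply, hcc]
  rw [mul_smul, e₁, h3, e₂]
  simp [e_apply, hne.symm]

theorem HasRootElements.exists_smul_eq_of_unit (hH : HasRootElements H) {κ β : Fin g ⊕ Fin g}
    (hκ : k ≤ idx κ) (hβ : k ≤ idx β) {c : ℤ} (hc : c = 1 ∨ c = -1) :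
    ∃ h ∈ lowerFix H k, h • c • e β = e κ := by
  by_cases hne : β = κ
  · subst hne
    obtain ⟨h₁, m₁, e₁⟩ := hH.exists_smul_eq_of_ne (κ := β.swap) (by simpa using hβ) hβ
      (swap_ne β).symm hc
    obtain ⟨h₂, m₂, e₂⟩ := hH.exists_smul_eq_of_ne (κ := β) (β := β.swap) hβ (by simpa using hβ)
      (swap_ne β) (Or.inl rfl)
    exact ⟨h₂ * h₁, mul_mem m₂ m₁, by rw [mul_smul, e₁]; simpa using e₂⟩
  · exact hH.exists_smul_eq_of_ne hκ hβ hne hc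

/-- Euclidean algorithm by descent on the ℓ¹ norm. Pairing to `1` with some `w` is preserved along
the way and forces the last surviving coordinate to be ±1. -/
theorem HasRootElements.exists_smul_eq (hH : HasRootElements H) {κ : Fin g ⊕ Fin g}
    (hκ : k ≤ idx κ) (N : ℕ) (v w : Fin g ⊕ Fin g → ℤ)
    (hv : ∀ α, (idx α : ℕ) < k → v α = 0) (hw : form v w = 1) (hN : ∑ α, (v α).natAbs = N) :
    ∃ h ∈ lowerFix H k, h • v = e κ := by
  induction N using Nat.strong_induction_on generalizing v w with
  | _ N ih =>
  have hle {α} (h : v α ≠ 0) : k ≤ idx α := by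
    by_contra h'; exact h (hv α (by lia))
  by_cases h2 : ∃ β γ, β ≠ γ ∧ v β ≠ 0 ∧ v γ ≠ 0
  · obtain ⟨β, γ, hne, hb, hc, hlt, hor⟩ : ∃ β γ, β ≠ γ ∧ v β ≠ 0 ∧ v γ ≠ 0 ∧
        (v γ).natAbs ≤ (v β).natAbs ∧ (γ = β.swap ∨ v β.swap = 0) := by
      -- If some pair has both coordinates nonzero, work inside it; otherwise the partner of every
      -- nonzero coordinate is zero. Either way the side condition of `exists_move` holds.
      by_cases h1 : ∃ β, v β ≠ 0 ∧ v β.swap ≠ 0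
      · obtain ⟨β, h3, h4⟩ := h1
        rcases le_total (v β).natAbs (v β.swap).natAbs with h | h
        · exact ⟨β.swap, β, swap_ne β, h4, h3, h, by simp⟩
        · exact ⟨β, β.swap, (swap_ne β).symm, h3, h4, h, by simp⟩
      · push Not at h1
        obtain ⟨β, γ, hne, hb, hc⟩ := h2
        rcases le_total (v β).natAbs (v γ).natAbs with h | h
        · exact ⟨γ, β, hne.symm, hc, hb, h, Or.inr (h1 _ hc)⟩
        · exact ⟨β, γ, hne, hb, hc, h, Or.inr (h1 _ hb)⟩
    obtain ⟨n, hn, hlt'⟩ : ∃ n : ℤ, (n = 1 ∨ n = -1) ∧ (v β + n * v γ).natAbs < (v β).natAbs := by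
      by_cases hs : 0 < v β ∧ 0 < v γ ∨ v β < 0 ∧ v γ < 0
      · exact ⟨-1, by simp, by lia⟩
      · exact ⟨1, by simp, by lia⟩
    obtain ⟨h, hh, he⟩ := hH.exists_move (hle hb) (hle hc) hne v hor hn
    have hsum : ∑ α, ((h • v) α).natAbs < N := by
      rw [← hN, he]
      refine Finset.sum_lt_sum (fun α _ => ?_) ⟨β, Finset.mem_univ _, ?_⟩
      · by_cases hα : α = β
        · subst hα; simpa [e_apply] using hlt'.le
        · simp [e_apply, hα]
      · simpa [e_apply] using hlt'
    have hlow : ∀ α, (idx α : ℕ) < k → (h • v) α = 0 := by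
      intro α hα
      rw [he]
      simp [hv α hα, e_apply_of_lt (hle hb) hα]
    obtain ⟨h', hh', he'⟩ := ih _ hsum (h • v) (h • w) hlow (by simpa using hw) rfl
    exact ⟨h' * h, mul_mem hh' hh, by rw [mul_smul, he']⟩
  · push Not at h2
    obtain ⟨β, hβ⟩ : ∃ β, v β ≠ 0 := by
      by_contra! h
      rw [show v = 0 from funext h] at hw
      simp [form] at hw
    have hvb : v = v β • e β := by
      ext α
      by_cases hα : α = β
      · simp [e_apply, hα]
      · simpa [e_apply, hα] using h2 β α (Ne.symm hα) hβ
    have hu : v β = 1 ∨ v β = -1 := by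
      rw [hvb, form_smul_left] at hw
      exact Int.isUnit_iff.1 (IsUnit.of_mul_eq_one _ hw)
    rw [hvb]
    exact hH.exists_smul_eq_of_unit hκ (hle hβ) hu

theorem HasRootElements.S_a_mem (hH : HasRootElements H) (k : Fin g) (z : Fin g ⊕ Fin g → ℤ)
    (hz : ∀ α, idx α = k → z α = 0) : S (a k) z ∈ H := by
  let N : AddSubgroup (Fin g ⊕ Fin g → ℤ) :=
    { carrier := {z | z (.inr k) = 0 ∧ S (a k) z ∈ H}
      zero_mem' := ⟨rfl, by
        convert one_mem H
        exact ext_smul fun x => by simp [S_smul (u := a k) (v := 0) (by simp), form]⟩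
      add_mem' := by
        rintro x y ⟨hx, hx'⟩ ⟨hy, hy'⟩
        refine ⟨by simp [hx, hy], ?_⟩
        have := S_mul_S (z := a k) (x := x) (y := y) (by simpa using hx) (by simpa using hy)
        rw [← mul_inv_eq_iff_eq_mul] at this
        rw [← this]
        exact mul_mem (mul_mem hx' hy') (inv_mem (zpow_mem (hH.long (.inl k)) _))
      neg_mem' := by
        rintro x ⟨hx, hx'⟩
        refine ⟨by simp [hx], ?_⟩
        rw [← S_inv (by simpa using hx)]
        exact inv_mem hx' }
  suffices z ∈ N from this.2
  have hsum : z = ∑ α, z α • e α := by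
    ext β
    simp [e_apply, Finset.sum_apply]
  rw [hsum]
  refine sum_mem fun α _ => ?_
  by_cases hα : idx α = k
  · rw [hz α hα, zero_smul]; exact zero_mem _
  · refine zsmul_mem (show e α ∈ N from ⟨?_, hH.short (.inl k) α ?_ ?_⟩) _
    · rw [e_apply, if_neg]; rintro rfl; exact hα rfl
    · rintro rfl; exact hα rfl
    · rintro rfl; exact hα rfl

/-- Induction on the number of hyperbolic pairs not yet fixed: an element of `H` brings the image of
the next pair back to that pair without disturbing the earlier ones. -/
theorem HasRootElements.eq_top (hH : HasRootElements H) : H = ⊤ := by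
  suffices ∀ d k : ℕ, d + k = g → ∀ M : symplecticGroup (Fin g) ℤ,
      (∀ α : Fin g ⊕ Fin g, (idx α : ℕ) < k → M • e α = e α) → M ∈ H from
    (Subgroup.eq_top_iff' H).2 fun M => this g 0 rfl M (by simp)
  intro d
  induction d with
  | zero =>
    intro k hk M hM
    obtain rfl : M = 1 := by
      apply Subtype.ext
      ext i j
      have := congrFun (hM j (by lia)) i
      change (M.1 *ᵥ Pi.single j 1) i = Pi.single (M := fun _ => ℤ) j 1 i at this
      simpa [Pi.single_apply, Matrix.one_apply] using this
    exact one_mem _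
  | succ d ih =>
    intro k hk M hM
    let κ : Fin g := ⟨k, by lia⟩
    have orth (M : symplecticGroup (Fin g) ℤ) (hM : ∀ α : Fin g ⊕ Fin g, (idx α : ℕ) < k → M • e α = e α)
        (β : Fin g ⊕ Fin g) (hβ : k ≤ idx β) (α) (hα : (idx α : ℕ) < k) : (M • e β) α = 0 := by
      obtain ⟨s, hs, hf⟩ := exists_sign_form_e α.swap
      have h1 := form_smul_smul M (e α.swap) (e β)
      rw [hM _ (by simpa using hα), hf, form_e_e] at h1
      · simpa using (mul_eq_zero.1 h1).resolve_left (by lia)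
      · rintro rfl; simp at hβ; lia
    obtain ⟨h, hh, he⟩ := hH.exists_smul_eq (k := k) (κ := .inl κ) le_rfl _ (M • a κ) (M • b κ)
      (orth M hM (.inl κ) le_rfl) (by simp) rfl
    obtain ⟨hhH, hfix⟩ := mem_lowerFix.1 hh
    have hM' : ∀ α : Fin g ⊕ Fin g, (idx α : ℕ) < k → (h * M) • e α = e α := fun α hα => by
      rw [mul_smul, hM α hα, hfix α hα]
    have hMa : (h * M) • a κ = a κ := by rw [mul_smul, he]; rfl
    set w := (h * M) • b κ with hw
    have hwk : w (.inr κ) = 1 := by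
      rw [← form_a κ w, hw, ← hMa, form_smul_smul]; simp
    -- As `w` has `b κ`-coordinate `1`, `S (a κ) z` adds exactly `z` plus a multiple of `a κ`, which
    -- clears `w` outside the pair `κ`; a power of `T (a κ)` then removes the `a κ` term.
    let z : Fin g ⊕ Fin g → ℤ := fun α => if idx α = κ then 0 else -w α
    have hz : ∀ α, idx α = κ → z α = 0 := fun α hα => if_pos hα
    have hzl : ∀ α, (idx α : ℕ) < k → z α = 0 := fun α hα => by
      simp only [z]
      rw [show w α = 0 from orth (h * M) hM' (.inr κ) le_rfl α hα, neg_zero, ite_self]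
    have hal : ∀ α, (idx α : ℕ) < k → a κ α = 0 := fun α => e_apply_of_lt (β := .inl κ) le_rfl
    have haz : form (a κ) z = 0 := by rw [form_a]; exact hz _ rfl
    obtain ⟨hS, hS'⟩ := mem_lowerFix.1 (S_mem_lowerFix haz (hH.S_a_mem κ z hz) hal hzl)
    obtain ⟨c, hc⟩ : ∃ c : ℤ, S (a κ) z • w = b κ + c • a κ := by
      refine ⟨w (.inl κ) + form z w, ?_⟩
      rw [S_smul haz, form_a, hwk]
      ext α
      by_cases hα : idx α = κ
      · rcases α with i | i <;> obtain rfl : i = κ := hα <;> simp [z, idx, hwk]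
      · rcases α with i | i <;> simp [idx] at hα <;> simp [z, idx, hα, Ne.symm hα]
    obtain ⟨hT, hT'⟩ := mem_lowerFix.1 (zpow_mem
      (T_mem_lowerFix (v := a κ) (hH.long (.inl κ)) hal) (-c))
    have hmem : T (a κ) ^ (-c) * S (a κ) z * (h * M) ∈ H := by
      refine ih (k + 1) (by lia) _ fun α hα => ?_
      by_cases hαk : (idx α : ℕ) < k
      · rw [mul_smul, hM' α hαk, mul_smul, hS' α hαk, hT' α hαk]
      · have hακ : idx α = κ := Fin.ext (show (idx α : ℕ) = k by lia)
        rcases α with i | i <;> obtain rfl : i = κ := hακ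
        · change _ • a κ = a κ
          rw [mul_smul, hMa, mul_smul, S_smul haz, T_zpow_smul]
          have : z (.inr κ) = 0 := hz _ rfl
          simp [this]
        · change _ • b κ = b κ
          rw [mul_smul, ← hw, mul_smul, hc, T_zpow_smul]
          simp
    rw [mul_mem_cancel_left (mul_mem hT hS), mul_mem_cancel_left hhH] at hmem
    exact hmem

end Generation

/-! ### From linear root elements and a twist to all root elements. -/

section RootElements

variable {l : Type*} [Fintype l] [DecidableEq l] {H : Subgroup (symplecticGroup l ℤ)}
  {u v x y z : l ⊕ l → ℤ}

theorem T_smul_mem {M : symplecticGroup l ℤ} (hM : M ∈ H) (h : T v ∈ H) : T (M • v) ∈ H := by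
  rw [← conj_T]; exact mul_mem (mul_mem hM h) (inv_mem hM)

theorem S_smul_mem {M : symplecticGroup l ℤ} (hM : M ∈ H) (h : S u v ∈ H) :
    S (M • u) (M • v) ∈ H := by
  rw [← conj_S]; exact mul_mem (mul_mem hM h) (inv_mem hM)

theorem S_neg_mem (h0 : form u v = 0) (h : S u v ∈ H) : S u (-v) ∈ H := by
  rw [← S_inv h0]; exact inv_mem h

theorem S_mem_of_add (hx : form z x = 0) (hy : form z y = 0) (hxy : form x y = 0)
    (h1 : S z x ∈ H) (h2 : S z (x + y) ∈ H) : S z y ∈ H := by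
  have := S_mul_S hx hy
  rw [hxy, zpow_zero, mul_one] at this
  rw [← this] at h2
  exact (mul_mem_cancel_left h1).1 h2

theorem T_mem_of_S (hx : form z x = 0) (hy : form z y = 0) (hxy : form x y = 1 ∨ form x y = -1)
    (h1 : S z x ∈ H) (h2 : S z y ∈ H) (h3 : S z (x + y) ∈ H) : T z ∈ H := by
  have h := mul_mem h1 h2
  rw [S_mul_S hx hy, mul_mem_cancel_left h3] at h
  rcases hxy with h' | h' <;> rw [h'] at h <;> simpa using h

theorem S_a_b_smul {i j : l} (hij : i ≠ j) (x : l ⊕ l → ℤ) :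
    S (a i) (b j) • x = x + x (.inr i) • b j - x (.inl j) • a i := by
  rw [S_smul (by simp [hij]), form_a, form_b]; module

theorem S_a_b_inv_smul {i j : l} (hij : i ≠ j) (x : l ⊕ l → ℤ) :
    (S (a i) (b j))⁻¹ • x = x - x (.inr i) • b j + x (.inl j) • a i := by
  rw [S_inv (by simp [hij]), S_smul (by simp [hij, hij.symm]), form_a, form_neg_left, form_b]
  module

/-- An element `R` moving the pairs `i, j` to `j, k` with a twist of order six, together with
the linear root elements, yields the transvections along `a k` and `b i`. -/
theorem T_mem_of_twist (hX : ∀ i j : l, i ≠ j → S (a i) (b j) ∈ H) {i j k : l} (hij : i ≠ j)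
    (hik : i ≠ k) (hjk : j ≠ k) {R : symplecticGroup l ℤ} (hR : R ∈ H)
    (hai : R • a i = a j - b j) (hbi : R • b i = a j) (haj : R • a j = a k - b k)
    (hbj : R • b j = a k) : T (a k) ∈ H ∧ T (b i) ∈ H := by
  have hji := hij.symm
  have hki := hik.symm
  have hkj := hjk.symm
  constructor
  -- Conjugating by `R` mixes `a j` and `b j`. The linear elements then isolate `S (a k) (a j)` and
  -- `S (a k) (-b j)`, whose product differs from `S (a k) (a j - b j)` by `T (a k)` to the power
  -- ±1.
  · have h1 : S (a k) (a j - b j) ∈ H := by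
      have := S_smul_mem hR (hX i j hij)
      rwa [hai, hbj, S_comm (by simp [hkj, hjk])] at this
    have h2 : S (a k) (a j - b j + -a i) ∈ H := by
      have := S_smul_mem (hX i j hij) h1
      rw [S_a_b_smul hij, S_a_b_smul hij] at this
      convert this using 2
      · simp [hij, hik, hji, hki, hjk, hkj]
      · simp [hij, hik, hji, hki, hjk, hkj]; abel
    have h3 : S (a k) (-a i) ∈ H :=
      S_mem_of_add (by simp [hjk, hkj]) (by simp) (by simp [hij, hji, form_sub_left]) h1 h2
    have h4 : S (a k) (a i) ∈ H := by simpa using S_neg_mem (by simp) h3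
    have h5 : S (a k) (a i + -a j) ∈ H := by
      have := S_smul_mem (hX j i hji) h4
      rw [S_a_b_smul hji, S_a_b_smul hji] at this
      convert this using 2
      · simp [hij, hik, hji, hki, hjk, hkj]
      · simp [hij, hik, hji, hki, hjk, hkj]; abel
    have h6 : S (a k) (-a j) ∈ H := S_mem_of_add (by simp) (by simp) (by simp) h4 h5
    have h7 : S (a k) (a j) ∈ H := by simpa using S_neg_mem (by simp) h6
    have h8 : S (a k) (-b j) ∈ H := S_neg_mem (by simp [hjk, hkj]) (hX k j hkj)
    exact T_mem_of_S (by simp) (by simp [hjk, hkj]) (by simp) h7 h8 (by rwa [← sub_eq_add_neg])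
  -- The same argument with `R⁻¹`, which sends `a j`, `b k` to `b i`, `b j - a j`.
  · have hai' : R⁻¹ • a j = b i := by rw [← hbi, inv_smul_smul]
    have hbj' : R⁻¹ • b k = b j - a j := by
      rw [inv_smul_eq_iff, smul_sub, hbj, haj]; abel
    have h1 : S (b i) (b j - a j) ∈ H := by
      have := S_smul_mem (inv_mem hR) (hX j k hjk)
      rwa [hai', hbj'] at this
    have h2 : S (b i) (b j - a j + b k) ∈ H := by
      have := S_smul_mem (hX j k hjk) h1
      rw [S_a_b_smul hjk, S_a_b_smul hjk] at this
      convert this using 2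
      · simp [hij, hik, hji, hki, hjk, hkj]
      · simp [hij, hik, hji, hki, hjk, hkj]
    have h3 : S (b i) (b k) ∈ H :=
      S_mem_of_add (by simp [hij, hji]) (by simp) (by simp [hjk, hkj, form_sub_left]) h1 h2
    have h5 : S (b i) (b k + b j) ∈ H := by
      have := S_smul_mem (hX k j hkj) h3
      rw [S_a_b_smul hkj, S_a_b_smul hkj] at this
      convert this using 2
      · simp [hij, hik, hji, hki, hjk, hkj]
      · simp [hij, hik, hji, hki, hjk, hkj]
    have h6 : S (b i) (b j) ∈ H := S_mem_of_add (by simp) (by simp) (by simp) h3 h5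
    have h7 : S (b i) (-a j) ∈ H := by
      refine S_neg_mem (by simp [hij, hji]) ?_
      rw [S_comm (by simp [hij, hji])]; exact hX j i hji
    exact T_mem_of_S (by simp) (by simp [hij, hji]) (by simp) h6 h7 (by rwa [← sub_eq_add_neg])

/-- Two linear elements carry `a k` to `a k - a i` and then to `-a i`; the sign is invisible to `T`.
-/
theorem T_a_mem (hX : ∀ i j : l, i ≠ j → S (a i) (b j) ∈ H) {k : l} (h : T (a k) ∈ H) (i : l) :
    T (a i) ∈ H := by
  by_cases hik : i = k
  · rwa [hik]
  have hki := Ne.symm hik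
  have h1 := T_smul_mem (inv_mem (hX k i hki)) (T_smul_mem (hX i k hik) h)
  rw [S_a_b_smul hik, S_a_b_inv_smul hki] at h1
  rw [← T_neg]
  convert h1 using 2
  simp [hik, hki]
  abel

theorem T_b_mem (hX : ∀ i j : l, i ≠ j → S (a i) (b j) ∈ H) {k : l} (h : T (b k) ∈ H) (i : l) :
    T (b i) ∈ H := by
  by_cases hik : i = k
  · rwa [hik]
  have hki := Ne.symm hik
  have h1 := T_smul_mem (inv_mem (hX i k hik)) (T_smul_mem (hX k i hki) h)
  rw [S_a_b_smul hki, S_a_b_inv_smul hik] at h1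
  convert h1 using 2
  simp [hik, hki]

theorem S_a_a_mem (hX : ∀ i j : l, i ≠ j → S (a i) (b j) ∈ H) (h : ∀ i, T (a i) ∈ H) {i j : l}
    (hij : i ≠ j) : S (a i) (a j) ∈ H := by
  refine mul_mem (mul_mem ?_ (inv_mem (h i))) (inv_mem (h j))
  have h1 := T_smul_mem (inv_mem (hX i j hij)) (h j)
  rw [S_a_b_inv_smul hij] at h1
  convert h1 using 2
  simp [add_comm]

theorem S_b_b_mem (hX : ∀ i j : l, i ≠ j → S (a i) (b j) ∈ H) (h : ∀ i, T (b i) ∈ H) {i j : l}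
    (hij : i ≠ j) : S (b i) (b j) ∈ H := by
  refine mul_mem (mul_mem ?_ (inv_mem (h i))) (inv_mem (h j))
  have h1 := T_smul_mem (hX i j hij) (h i)
  rw [S_a_b_smul hij] at h1
  convert h1 using 2
  simp

theorem eq_top_of_linear_of_long {g : ℕ} {H : Subgroup (symplecticGroup (Fin g) ℤ)}
    (hX : ∀ i j : Fin g, i ≠ j → S (a i) (b j) ∈ H) {i j : Fin g} (hi : T (a i) ∈ H)
    (hj : T (b j) ∈ H) : H = ⊤ := by
  have hA := T_a_mem hX hi
  have hB := T_b_mem hX hj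
  refine HasRootElements.eq_top ⟨?_, ?_⟩
  · rintro (i | i)
    exacts [hA i, hB i]
  · rintro (i | i) (j | j) h1 h2
    · exact S_a_a_mem hX hA (i := i) (j := j) (by rintro rfl; simp at h1)
    · exact hX i j (by rintro rfl; simp at h2)
    · have hji : j ≠ i := by rintro rfl; simp at h2
      have := hX j i hji
      rwa [S_comm (by simp [hji])] at this
    · exact S_b_b_mem hX hB (i := i) (j := j) (by rintro rfl; simp at h1)

end RootElements

/-! ### Block-diagonal matrices, permutation matrices and the involutions `κ`. -/

section Local

variable {l : Type*} [Fintype l]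

/-- The endomorphism acting on the `i`-th hyperbolic pair through `p i`. -/
def locEnd (p : l → SpecialLinearGroup (Fin 2) ℤ) : (l ⊕ l → ℤ) →ₗ[ℤ] (l ⊕ l → ℤ) where
  toFun x := Sum.elim (fun i => p i 0 0 * x (.inl i) + p i 0 1 * x (.inr i))
    (fun i => p i 1 0 * x (.inl i) + p i 1 1 * x (.inr i))
  map_add' x y := by ext (i | i) <;> simp <;> ring
  map_smul' n x := by ext (i | i) <;> simp <;> ring

theorem form_locEnd (p : l → SpecialLinearGroup (Fin 2) ℤ) (x y : l ⊕ l → ℤ) :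
    form (locEnd p x) (locEnd p y) = form x y := by
  refine Finset.sum_congr rfl fun i _ => ?_
  have := (p i).det_coe
  rw [det_fin_two] at this
  simp only [locEnd, LinearMap.coe_mk, AddHom.coe_mk, Sum.elim_inl, Sum.elim_inr]
  linear_combination (x (.inl i) * y (.inr i) - x (.inr i) * y (.inl i)) * this

end Local

section Monomial

variable {l : Type*} [Fintype l] [DecidableEq l]

/-- The symplectic matrix permuting the hyperbolic pairs. -/
def perm : Equiv.Perm l →* symplecticGroup l ℤ where
  toFun σ := ofEnd (LinearMap.funLeft ℤ ℤ (Sum.map ⇑σ⁻¹ ⇑σ⁻¹)) fun x y => by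
    simp only [form, LinearMap.funLeft_apply, Sum.map_inl, Sum.map_inr]
    exact Equiv.sum_comp σ⁻¹ fun i => x (.inl i) * y (.inr i) - x (.inr i) * y (.inl i)
  map_one' := ext_smul fun x => by ext (i | i) <;> simp [LinearMap.funLeft_apply]
  map_mul' σ τ := ext_smul fun x => by
    rw [mul_smul]; ext (i | i) <;> simp [LinearMap.funLeft_apply]

theorem perm_smul_inl (σ : Equiv.Perm l) (x : l ⊕ l → ℤ) (i : l) :
    (perm σ • x) (.inl i) = x (.inl (σ⁻¹ i)) :=
  by simp [perm, LinearMap.funLeft_apply]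

theorem perm_smul_inr (σ : Equiv.Perm l) (x : l ⊕ l → ℤ) (i : l) :
    (perm σ • x) (.inr i) = x (.inr (σ⁻¹ i)) :=
  by simp [perm, LinearMap.funLeft_apply]

@[simp] theorem perm_smul_a (σ : Equiv.Perm l) (i : l) : perm σ • a i = a (σ i) := by
  ext (j | j)
  · simp [perm_smul_inl, Equiv.eq_symm_apply]
  · simp [perm_smul_inr]

@[simp] theorem perm_smul_b (σ : Equiv.Perm l) (i : l) : perm σ • b i = b (σ i) := by
  ext (j | j)
  · simp [perm_smul_inl]
  · simp [perm_smul_inr, Equiv.eq_symm_apply]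

/-- The symplectic matrix acting on the `i`-th hyperbolic pair through `p i`. -/
def loc : (l → SpecialLinearGroup (Fin 2) ℤ) →* symplecticGroup l ℤ where
  toFun p := ofEnd (locEnd p) (form_locEnd p)
  map_one' := ext_smul fun x => by ext (i | i) <;> simp [locEnd]
  map_mul' p q := ext_smul fun x => by
    rw [mul_smul, ofEnd_smul, ofEnd_smul, ofEnd_smul]
    ext (i | i) <;> simp [locEnd, Matrix.mul_apply] <;> ring

theorem loc_smul (p : l → SpecialLinearGroup (Fin 2) ℤ) (x : l ⊕ l → ℤ) :
    loc p • x = Sum.elim (fun i => p i 0 0 * x (.inl i) + p i 0 1 * x (.inr i))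
      (fun i => p i 1 0 * x (.inl i) + p i 1 1 * x (.inr i)) :=
  ofEnd_smul (locEnd p) (form_locEnd p) x

theorem smul_zsmul' (M : symplecticGroup l ℤ) (n : ℤ) (x : l ⊕ l → ℤ) : M • n • x = n • M • x :=
  smul_comm _ _ _

@[simp] theorem loc_smul_a (p : l → SpecialLinearGroup (Fin 2) ℤ) (i : l) :
    loc p • a i = p i 0 0 • a i + p i 1 0 • b i := by
  rw [loc_smul]; ext (j | j) <;> simp <;> grind

@[simp] theorem loc_smul_b (p : l → SpecialLinearGroup (Fin 2) ℤ) (i : l) :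
    loc p • b i = p i 0 1 • a i + p i 1 1 • b i := by
  rw [loc_smul]; ext (j | j) <;> simp <;> grind

theorem perm_mul_loc (σ : Equiv.Perm l) (p : l → SpecialLinearGroup (Fin 2) ℤ) :
    perm σ * loc p = loc (p ∘ ⇑σ⁻¹) * perm σ :=
  ext_smul fun x => by
    rw [mul_smul, mul_smul]
    ext (i | i) <;> simp [loc_smul, perm_smul_inl, perm_smul_inr]

/-- The involution negating the `i`-th hyperbolic pair. -/
def δ (i : l) : symplecticGroup l ℤ := loc (Pi.mulSingle i (-1))

theorem δ_smul (i : l) (x : l ⊕ l → ℤ) :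
    δ i • x = x - (2 * x (.inl i)) • a i - (2 * x (.inr i)) • b i := by
  rw [δ, loc_smul]
  ext (j | j) <;> rcases eq_or_ne i j with rfl | h <;> simp_all [Pi.mulSingle_apply, Ne.symm] <;>
    ring

/-- The involution `δ i * S (a i) (b j)`. -/
def κ (i j : l) : symplecticGroup l ℤ := δ i * S (a i) (b j)

theorem κ_smul {i j : l} (hij : i ≠ j) (x : l ⊕ l → ℤ) :
    κ i j • x = x - (2 * x (.inl i) - x (.inl j)) • a i - (2 * x (.inr i)) • b i
      + x (.inr i) • b j := by
  rw [κ, mul_smul, S_a_b_smul hij, δ_smul]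
  simp [hij, hij.symm, -zsmul_eq_mul]
  module

/-- `δ i` negates `a i` and fixes `b j`, so it inverts `S (a i) (b j)`. -/
theorem κ_mul_self {i j : l} (hij : i ≠ j) : κ i j * κ i j = 1 :=
  ext_smul fun x => by
    rw [mul_smul, κ_smul hij (κ i j • x), κ_smul hij, one_smul]
    simp [hij, hij.symm, -zsmul_eq_mul]
    module

theorem conj_perm_κ (σ : Equiv.Perm l) {i j : l} (hij : i ≠ j) :
    perm σ * κ i j * (perm σ)⁻¹ = κ (σ i) (σ j) := by
  rw [mul_inv_eq_iff_eq_mul]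
  refine ext_smul fun x => ?_
  rw [mul_smul, mul_smul, κ_smul hij, κ_smul (by simpa using hij)]
  simp [perm_smul_inl, perm_smul_inr, smul_sub, smul_add, smul_zsmul', -zsmul_eq_mul]

/-- In `κ i j * (κ i k)⁻¹` the factors `δ i` combine to leave a single root element, and the
permutations needed to form it are even. The hypotheses use `κ` multiplied by a transposition
because three involutions give only even permutations at this stage. -/
theorem S_a_b_mem_of_swap_mul_κ {H : Subgroup (symplecticGroup l ℤ)}
    (hA : ∀ σ : Equiv.Perm l, σ.sign = 1 → perm σ ∈ H)
    (hK : ∀ i j : l, i ≠ j → perm (Equiv.swap i j) * κ i j ∈ H) {i j k : l} (hij : i ≠ j)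
    (hik : i ≠ k) (hjk : j ≠ k) : S (a k) (b j) ∈ H := by
  have hji := hij.symm
  have hki := hik.symm
  have hkj := hjk.symm
  have h0 : form (a k) (b i - b j) = 0 := by simp [hik, hjk]
  have h1 : S (a k) (b i - b j) ∈ H := by
    have h2 : S (a k) (b i - b j) = (perm (Equiv.swap i k * Equiv.swap i j)) *
        (perm (Equiv.swap i j) * κ i j) * (perm (Equiv.swap i k) * κ i k)⁻¹ := by
      have h3 : S (a k) (b i - b j) * (perm (Equiv.swap i k) * κ i k) =
          perm (Equiv.swap i k) * κ i j := ext_smul fun x => by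
        rw [mul_smul, mul_smul, mul_smul, κ_smul hik, κ_smul hij, S_smul h0]
        simp [smul_add, smul_sub, smul_zsmul', -zsmul_eq_mul, perm_smul_inl, perm_smul_inr,
          Equiv.swap_apply_of_ne_of_ne, form_sub_left, hij, hik, hji, hjk, hki, hkj]
        generalize perm (Equiv.swap i k) • x = y
        module
      rw [eq_mul_inv_iff_mul_eq, h3, ← mul_assoc, ← map_mul, mul_assoc, Equiv.swap_mul_self,
        mul_one]
    rw [h2]
    refine mul_mem (mul_mem (hA _ ?_) (hK i j hij)) (inv_mem (hK i k hik))
    simp [Equiv.Perm.sign_swap, hij, hik]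
  -- This conjugation fixes `a k` and sends `b i - b j` to `-b j`.
  have h3 := S_smul_mem (hK i j hij) h1
  have e1 : (perm (Equiv.swap i j) * κ i j) • a k = a k := by
    rw [mul_smul, κ_smul hij]; simp [hki, hkj, hik, hjk, Equiv.swap_apply_of_ne_of_ne]
  have e2 : (perm (Equiv.swap i j) * κ i j) • (b i - b j) = -b j := by
    rw [mul_smul, κ_smul hij]; simp [hij, hji, smul_add, smul_sub, smul_zsmul', -zsmul_eq_mul]; abel
  rw [e1, e2] at h3
  simpa using S_neg_mem (by simp [hjk]) h3

end Monomial

/-! ### Generating symmetric and alternating groups. -/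

section Symmetric

/-- The transposition of `i` and `i + 1`. -/
def adj {g : ℕ} (i : ℕ) (h : i + 1 < g) : Equiv.Perm (Fin g) :=
  Equiv.swap ⟨i, by lia⟩ ⟨i + 1, h⟩

variable {g : ℕ} {K : Subgroup (Equiv.Perm (Fin g))}

theorem sign_adj (i : ℕ) (h : i + 1 < g) : (adj i h).sign = -1 :=
  Equiv.Perm.sign_swap (by simp)

theorem induction_adj {p : Equiv.Perm (Fin g) → Prop} (one : p 1)
    (mul_adj : ∀ σ i (h : i + 1 < g), p σ → p (σ * adj i h)) (σ : Equiv.Perm (Fin g)) : p σ := by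
  rcases g with _ | n
  · rwa [Subsingleton.elim σ 1]
  have hσ : σ ∈ Submonoid.closure (Set.range fun i : Fin n => Equiv.swap i.castSucc i.succ) := by
    rw [Equiv.Perm.mclosure_swap_castSucc_succ]; trivial
  induction hσ using Submonoid.closure_induction_right with
  | one => exact one
  | mul_right x _ y hy ih =>
    obtain ⟨i, rfl⟩ := hy
    exact mul_adj x i (by lia) ih

theorem mem_of_adj_mem (h : ∀ i (hi : i + 1 < g), adj i hi ∈ K) (σ : Equiv.Perm (Fin g)) :
    σ ∈ K :=
  induction_adj (one_mem K) (fun _ i hi hσ => mul_mem hσ (h i hi)) σ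

theorem mem_of_adj_mul_adj_mem (hg : 2 ≤ g)
    (h : ∀ i (hi : i + 2 < g), adj i (by lia) * adj (i + 1) hi ∈ K) (σ : Equiv.Perm (Fin g))
    (hσ : σ.sign = 1) : σ ∈ K := by
  have h0 (i) (hi : i + 1 < g) : adj 0 hg * adj i hi ∈ K := by
    induction i with
    | zero => rw [adj, Equiv.swap_mul_self]; exact one_mem K
    | succ i ih =>
      have := mul_mem (ih (by lia)) (h i hi)
      rwa [mul_assoc, ← mul_assoc (adj i _), adj, adj, Equiv.swap_mul_self, one_mul] at this
  -- Odd permutations are carried along, corrected by `adj 0`, so that the induction can proceed one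
  -- adjacent transposition at a time.
  suffices (σ.sign = 1 → σ ∈ K) ∧ (σ.sign = -1 → σ * adj 0 hg ∈ K) from this.1 hσ
  clear hσ
  induction σ using induction_adj with
  | one => exact ⟨fun _ => one_mem K, fun h => absurd h (by simp)⟩
  | mul_adj σ i hi ih =>
    rw [map_mul, sign_adj]
    constructor
    · intro hs
      have := mul_mem (ih.2 (by simpa [neg_eq_iff_eq_neg] using hs)) (h0 i hi)
      rwa [mul_assoc, ← mul_assoc (adj 0 _), adj, Equiv.swap_mul_self, one_mul] at this
    · intro hs
      have := mul_mem (ih.1 (by simpa using hs)) (inv_mem (h0 i hi))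
      rwa [_root_.mul_inv_rev, ← mul_assoc, adj, adj, Equiv.swap_inv, Equiv.swap_inv] at this

theorem exists_perm_apply_eq {l : Type*} [DecidableEq l] {i j i' j' : l} (h : i ≠ j)
    (h' : i' ≠ j') : ∃ σ : Equiv.Perm l, σ i = i' ∧ σ j = j' := by
  refine ⟨Equiv.swap (Equiv.swap i i' j) j' * Equiv.swap i i', ?_, ?_⟩
  · rw [Equiv.Perm.mul_apply, Equiv.swap_apply_left, Equiv.swap_apply_of_ne_of_ne _ h']
    rw [ne_comm, Ne, Equiv.swap_apply_eq_iff, Equiv.swap_apply_right]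
    exact h.symm
  · rw [Equiv.Perm.mul_apply, Equiv.swap_apply_left]

/-- The spare points `p`, `q` allow the parity to be corrected by a transposition that avoids `i`
and `j`. -/
theorem exists_even_perm_apply_eq {l : Type*} [DecidableEq l] [Fintype l] {i j i' j' p q : l}
    (h : i ≠ j) (h' : i' ≠ j') (hpq : p ≠ q) (hip : i ≠ p) (hiq : i ≠ q) (hjp : j ≠ p)
    (hjq : j ≠ q) : ∃ σ : Equiv.Perm l, σ.sign = 1 ∧ σ i = i' ∧ σ j = j' := by
  obtain ⟨σ, h1, h2⟩ := exists_perm_apply_eq h h'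
  rcases Int.units_eq_one_or σ.sign with hs | hs
  · exact ⟨σ, hs, h1, h2⟩
  · exact ⟨σ * Equiv.swap p q, by rw [map_mul, hs, Equiv.Perm.sign_swap hpq]; rfl,
      by rw [Equiv.Perm.mul_apply, Equiv.swap_apply_of_ne_of_ne hip hiq, h1],
      by rw [Equiv.Perm.mul_apply, Equiv.swap_apply_of_ne_of_ne hjp hjq, h2]⟩

end Symmetric

/-! ### The twisted dihedral group. -/

section Dihedral

/-- An element of order six in `SL(2, ℤ)`. -/
def f : SpecialLinearGroup (Fin 2) ℤ := ⟨!![1, 1; -1, 0], by simp⟩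

variable {g : ℕ}

/-- The matrix acting on the `i`-th hyperbolic pair through `f ^ i`. -/
def gauge : symplecticGroup (Fin g) ℤ := loc fun i => f ^ (i : ℕ)

/-- The conjugate of a permutation matrix by `gauge`. -/
def tw (σ : Equiv.Perm (Fin g)) : symplecticGroup (Fin g) ℤ := gauge * perm σ * gauge⁻¹

theorem tw_mul (σ τ : Equiv.Perm (Fin g)) : tw (σ * τ) = tw σ * tw τ := by
  simp only [tw, map_mul]; group

theorem perm_injective : Function.Injective (perm : Equiv.Perm (Fin g) →* _) := by
  intro σ τ h
  ext1 i
  have := congrArg (fun M : symplecticGroup (Fin g) ℤ => (M • a i) (.inl (σ i))) h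
  simpa [eq_comm] using this

theorem orderOf_tw {σ : Equiv.Perm (Fin g)} (h : σ * σ = 1) (h1 : σ ≠ 1) : orderOf (tw σ) = 2 := by
  refine orderOf_eq_prime (by rw [pow_two, ← tw_mul, h]; simp [tw]) fun h2 => h1 ?_
  rw [tw, mul_inv_eq_one, mul_eq_left] at h2
  exact perm_injective (h2.trans (map_one _).symm)

/-- The reflection `i ↦ -i`. -/
def refl₂ : Equiv.Perm (Fin g) := Equiv.neg _

theorem refl₂_mul_self : (refl₂ : Equiv.Perm (Fin g)) * refl₂ = 1 := by
  ext1 i; simp [refl₂]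

variable [NeZero g]

theorem gauge_smul_a_zero : (gauge : symplecticGroup (Fin g) ℤ) • a (0 : Fin g) = a 0 := by
  simp [gauge]

theorem tw_smul_a_zero (σ : Equiv.Perm (Fin g)) :
    tw σ • a (0 : Fin g) = (gauge : symplecticGroup (Fin g) ℤ) • a (σ 0) := by
  rw [tw, mul_smul, inv_smul_eq_iff.2 gauge_smul_a_zero.symm, mul_smul, perm_smul_a]

/-- The reflection `i ↦ 1 - i`. -/
def refl₁ : Equiv.Perm (Fin g) := Equiv.subLeft 1

/-- The rotation `i ↦ i + 1`. -/
def rot : Equiv.Perm (Fin g) := refl₁ * refl₂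

theorem rot_apply (i : Fin g) : rot i = i + 1 := by
  simp [rot, refl₁, refl₂, add_comm]

theorem refl₁_mul_self : (refl₁ : Equiv.Perm (Fin g)) * refl₁ = 1 := by
  ext1 i; simp [refl₁]

theorem rot_mk {i : ℕ} (h : i + 1 < g) : rot (⟨i, by lia⟩ : Fin g) = ⟨i + 1, h⟩ := by
  rw [rot_apply]
  ext
  simp [Fin.val_add, Nat.mod_eq_of_lt h]

/-- The block at `i` is the quotient of consecutive powers of `f`, hence `f`, except where the
rotation wraps around at `0`. -/
theorem exists_tw_rot : ∃ p : Fin g → SpecialLinearGroup (Fin 2) ℤ,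
    (∀ i ≠ 0, p i = f) ∧ tw rot = loc p * perm rot := by
  refine ⟨fun j => f ^ (j : ℕ) * (f ^ ((rot⁻¹ j : Fin g) : ℕ))⁻¹, fun i hi => ?_, ?_⟩
  · obtain ⟨n, hn⟩ := Nat.exists_eq_succ_of_ne_zero (Fin.val_ne_zero_iff.2 hi)
    have : rot⁻¹ i = ⟨n, by lia⟩ := by
      rw [Equiv.Perm.inv_eq_iff_eq, rot_mk (by lia)]
      exact Fin.ext hn
    simp only [this, hn]
    rw [pow_succ']; group
  · rw [tw, mul_assoc, gauge, ← map_inv, perm_mul_loc, ← mul_assoc, ← map_mul]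
    rfl

theorem tw_rot_smul_a {i : ℕ} (h : i + 1 < g) :
    (tw rot : symplecticGroup (Fin g) ℤ) • a (⟨i, by lia⟩ : Fin g) = a ⟨i + 1, h⟩ - b ⟨i + 1, h⟩ := by
  obtain ⟨p, hp, hR⟩ := exists_tw_rot (g := g)
  rw [hR, mul_smul, perm_smul_a, rot_mk h, loc_smul_a, hp _ (by simp [Fin.ext_iff])]
  simp [f, sub_eq_add_neg]

theorem tw_rot_smul_b {i : ℕ} (h : i + 1 < g) :
    (tw rot : symplecticGroup (Fin g) ℤ) • b (⟨i, by lia⟩ : Fin g) = a ⟨i + 1, h⟩ := by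
  obtain ⟨p, hp, hR⟩ := exists_tw_rot (g := g)
  rw [hR, mul_smul, perm_smul_b, rot_mk h, loc_smul_b, hp _ (by simp [Fin.ext_iff])]
  simp [f]

/-- The twist is constant away from `0`, so it commutes with every permutation fixing `0`. -/
theorem conj_tw_rot_perm {σ : Equiv.Perm (Fin g)} (h : (rot * σ * rot⁻¹ : Equiv.Perm (Fin g)) 0 = 0) :
    tw rot * perm σ * (tw rot)⁻¹ = perm (rot * σ * rot⁻¹) := by
  obtain ⟨p, hp, hR⟩ := exists_tw_rot (g := g)
  have h1 : perm (rot * σ * rot⁻¹) * loc p = loc p * perm (rot * σ * rot⁻¹) := by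
    rw [perm_mul_loc]
    congr 2
    ext1 j
    by_cases hj : j = 0
    · rw [hj, Function.comp_apply, Equiv.Perm.inv_eq_iff_eq.2 h.symm]
    · rw [Function.comp_apply, hp j hj, hp]
      rwa [Ne, Equiv.Perm.inv_eq_iff_eq, h]
  rw [mul_inv_eq_iff_eq_mul, hR, ← mul_assoc, h1, mul_assoc, mul_assoc, ← map_mul, ← map_mul,
    inv_mul_cancel_right]

theorem conj_rot_adj {i : ℕ} (h : i + 2 < g) :
    rot * adj i (by lia) * rot⁻¹ = adj (i + 1) h := by
  rw [adj, adj, ← Equiv.swap_apply_apply, rot_mk, rot_mk]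

theorem adj_apply_zero {i : ℕ} (h : i + 2 < g) : adj (i + 1) h 0 = 0 :=
  Equiv.swap_apply_of_ne_of_ne (by simp [Fin.ext_iff]) (by simp [Fin.ext_iff])

variable {H : Subgroup (symplecticGroup (Fin g) ℤ)}

theorem perm_adj_mem (hR : tw rot ∈ H) (h0 : ∀ h : 0 + 1 < g, perm (adj 0 h) ∈ H) (i : ℕ)
    (h : i + 1 < g) : perm (adj i h) ∈ H := by
  induction i with
  | zero => exact h0 h
  | succ i ih =>
    rw [← conj_rot_adj h, ← conj_tw_rot_perm (by rw [conj_rot_adj h, adj_apply_zero])]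
    exact mul_mem (mul_mem hR (ih _)) (inv_mem hR)

theorem perm_adj_mul_adj_mem (hR : tw rot ∈ H)
    (h0 : ∀ h : 0 + 2 < g, perm (adj 0 (by lia) * adj 1 h) ∈ H) (i : ℕ) (h : i + 2 < g) :
    perm (adj i (by lia) * adj (i + 1) h) ∈ H := by
  induction i with
  | zero => exact h0 h
  | succ i ih =>
    have h1 : rot * (adj i (by lia) * adj (i + 1) (by lia)) * rot⁻¹
        = adj (i + 1) (by lia) * adj (i + 1 + 1) h := by
      rw [← conj_rot_adj h, ← conj_rot_adj (show i + 2 < g by lia)]; group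
    rw [← h1, ← conj_tw_rot_perm]
    · exact mul_mem (mul_mem hR (ih _)) (inv_mem hR)
    · rw [h1, Equiv.Perm.mul_apply, adj_apply_zero, adj_apply_zero]

theorem eq_top_of_tw_rot (hg : 3 ≤ g) (hR : tw rot ∈ H)
    (hA : ∀ σ : Equiv.Perm (Fin g), σ.sign = 1 → perm σ ∈ H)
    (hK : ∀ i j : Fin g, i ≠ j → perm (Equiv.swap i j) * κ i j ∈ H) : H = ⊤ := by
  have hX (i j : Fin g) (hij : i ≠ j) : S (a i) (b j) ∈ H := by
    obtain ⟨k, hki, hkj⟩ := Fin.exists_ne_and_ne_of_two_lt i j (by lia)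
    exact S_a_b_mem_of_swap_mul_κ hA hK hkj hki hij.symm
  obtain ⟨h1, h2⟩ := T_mem_of_twist hX (i := ⟨0, by lia⟩) (j := ⟨0 + 1, by lia⟩)
    (k := ⟨0 + 1 + 1, by lia⟩) (by simp) (by simp) (by simp) hR (tw_rot_smul_a (i := 0) (by lia))
    (tw_rot_smul_b (i := 0) (by lia)) (tw_rot_smul_a (i := 0 + 1) (by lia))
    (tw_rot_smul_b (i := 0 + 1) (by lia))
  exact eq_top_of_linear_of_long hX h1 h2

end Dihedral

/-! ### The generating involutions. -/

section Involutions

variable {g : ℕ}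

theorem orderOf_tw_refl₁ [NeZero g] (hg : 2 ≤ g) :
    orderOf (tw refl₁ : symplecticGroup (Fin g) ℤ) = 2 := by
  refine orderOf_tw refl₁_mul_self fun h => ?_
  have := congrArg (fun σ : Equiv.Perm (Fin g) => ((σ 0 : Fin g) : ℕ)) h
  simp [refl₁, Nat.mod_eq_of_lt (show 1 < g by lia)] at this

theorem orderOf_tw_refl₂ [NeZero g] (hg : 3 ≤ g) :
    orderOf (tw refl₂ : symplecticGroup (Fin g) ℤ) = 2 := by
  refine orderOf_tw refl₂_mul_self fun h => ?_
  have := congrArg (fun σ : Equiv.Perm (Fin g) => ((σ 1 : Fin g) : ℕ)) h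
  -- The reflection sends `1` to `g - 1`, which differs from `1` since `g ≥ 3`; for `g = 2` it would
  -- be trivial.
  simp [refl₂, Fin.val_neg', Nat.mod_eq_of_lt (show 1 < g by lia),
    Nat.mod_eq_of_lt (show g - 1 < g by lia)] at this
  lia

/-- A functional separating the images of `a 0` under the generating involutions. -/
def separator (hg : 2 ≤ g) (M : symplecticGroup (Fin g) ℤ) : ℤ :=
  -- The weights give distinct values at the images `a 1 - b 1`, `a 0`, `a 1` and `-a 0` of `a 0`.
  5 * (M • a (⟨0, by lia⟩ : Fin g)) (.inl ⟨0, by lia⟩)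
    + (M • a (⟨0, by lia⟩ : Fin g)) (.inl ⟨1, by lia⟩)
    + 2 * (M • a (⟨0, by lia⟩ : Fin g)) (.inr ⟨1, by lia⟩)

theorem separator_tw_refl₁ [NeZero g] (hg : 2 ≤ g) : separator hg (tw refl₁) = -1 := by
  have h : (refl₁ (0 : Fin g)) = ⟨1, by lia⟩ := by
    ext; simp [refl₁, Nat.mod_eq_of_lt (show 1 < g by lia)]
  have h1 : (tw refl₁ : symplecticGroup (Fin g) ℤ) • a (⟨0, by lia⟩ : Fin g) =
      a (⟨1, by lia⟩ : Fin g) - b (⟨1, by lia⟩ : Fin g) := by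
    rw [show (⟨0, by lia⟩ : Fin g) = 0 from rfl, tw_smul_a_zero, h, gauge, loc_smul_a,
      show f ^ ((⟨1, by lia⟩ : Fin g) : ℕ) = f from pow_one f]
    simp [f, sub_eq_add_neg]
  rw [separator, h1]
  simp

theorem separator_tw_refl₂ [NeZero g] (hg : 2 ≤ g) : separator hg (tw refl₂) = 5 := by
  have h1 : (tw refl₂ : symplecticGroup (Fin g) ℤ) • a (⟨0, by lia⟩ : Fin g) =
      a (⟨0, by lia⟩ : Fin g) := by
    rw [show (⟨0, by lia⟩ : Fin g) = 0 from rfl, tw_smul_a_zero,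
      show refl₂ (0 : Fin g) = 0 by simp [refl₂], gauge_smul_a_zero]
  rw [separator, h1]
  simp

theorem separator_perm (hg : 2 ≤ g) : separator hg (perm (adj 0 hg)) = 1 := by
  simp [separator, adj]

theorem separator_κ (hg : 2 ≤ g) :
    separator hg (κ ⟨0, by lia⟩ ⟨1, by lia⟩) = -5 := by
  rw [separator, κ_smul (by simp)]
  simp

theorem orderOf_κ {i j : Fin g} (h : i ≠ j) : orderOf (κ i j) = 2 := by
  refine orderOf_eq_prime (by rw [pow_two, κ_mul_self h]) fun h1 => ?_
  have := congrFun (congrArg (fun M : symplecticGroup (Fin g) ℤ => M • a i) h1) (.inl i)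
  simp [κ_smul h, h, h.symm] at this

theorem orderOf_perm_adj {i : ℕ} (h : i + 1 < g) : orderOf (perm (adj i h)) = 2 := by
  rw [orderOf_injective perm perm_injective]
  exact Equiv.Perm.IsSwap.orderOf ⟨_, _, by simp, rfl⟩

theorem rot_mem [NeZero g] {H : Subgroup (symplecticGroup (Fin g) ℤ)} (h₁ : tw refl₁ ∈ H)
    (h₂ : tw refl₂ ∈ H) : tw rot ∈ H := by
  rw [rot, tw_mul]; exact mul_mem h₁ h₂

theorem exists_four_involutions (hg : 3 ≤ g) :
    ∃ ρ : Fin 4 → symplecticGroup (Fin g) ℤ,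
      Function.Injective ρ ∧ (∀ i, orderOf (ρ i) = 2) ∧
        Subgroup.closure (Set.range ρ) = ⊤ := by
  have : NeZero g := ⟨by lia⟩
  let ρ : Fin 4 → symplecticGroup (Fin g) ℤ :=
    ![tw refl₁, tw refl₂, perm (adj 0 (by lia)), κ ⟨0, by lia⟩ ⟨1, by lia⟩]
  refine ⟨ρ, ?_, ?_, ?_⟩
  · refine Function.Injective.of_comp (f := separator (show 2 ≤ g by lia)) ?_
    have : separator (show 2 ≤ g by lia) ∘ ρ = ![-1, 5, 1, -5] := by
      ext i
      fin_cases i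
      exacts [separator_tw_refl₁ _, separator_tw_refl₂ _, separator_perm _, separator_κ _]
    rw [this]
    decide
  · intro i
    fin_cases i
    exacts [orderOf_tw_refl₁ (by lia), orderOf_tw_refl₂ hg, orderOf_perm_adj _,
      orderOf_κ (by simp)]
  · have hρ (i) : ρ i ∈ Subgroup.closure (Set.range ρ) := Subgroup.subset_closure ⟨i, rfl⟩
    have hR := rot_mem (hρ 0) (hρ 1)
    have hP (σ : Equiv.Perm (Fin g)) : perm σ ∈ Subgroup.closure (Set.range ρ) :=
      mem_of_adj_mem (K := (Subgroup.closure (Set.range ρ)).comap perm)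
        (perm_adj_mem hR fun _ => hρ 2) σ
    refine eq_top_of_tw_rot hg hR (fun σ _ => hP σ) fun i j hij => mul_mem (hP _) ?_
    have h01 : (⟨0, by lia⟩ : Fin g) ≠ ⟨1, by lia⟩ := by simp
    obtain ⟨σ, rfl, rfl⟩ := exists_perm_apply_eq h01 hij
    rw [← conj_perm_κ σ h01]
    exact mul_mem (mul_mem (hP σ) (hρ 3)) (inv_mem (hP σ))

/-- Intended for `s`, `s'` adjacent transpositions and `k`, `k'` the accompanying `κ` factors, which
drop out of the commutator. -/
theorem commutator_mul_eq {G : Type*} [Group G] {s s' k k' : G} (h2 : Commute k s')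
    (h3 : Commute k' s) (h5 : Commute k k') :
    s * k * (s' * k') * (s * k)⁻¹ * (s' * k')⁻¹ = s * s' * s⁻¹ * s'⁻¹ := by
  have h6 : s * k * (s' * k') = s * s' * (k * k') := h2.mul_mul_mul_comm s k'
  have h7 : s' * k' * (s * k) = s' * s * (k * k') := by
    rw [h5.eq]; exact h3.mul_mul_mul_comm s' k
  rw [mul_assoc, ← _root_.mul_inv_rev, h6, h7]
  group

theorem commute_perm_κ {l : Type*} [Fintype l] [DecidableEq l] {σ : Equiv.Perm l} {i j : l}
    (hij : i ≠ j) (hi : σ i = i) (hj : σ j = j) : Commute (κ i j) (perm σ) := by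
  have := conj_perm_κ σ hij
  rw [hi, hj, mul_inv_eq_iff_eq_mul] at this
  exact this.symm

theorem conj_κ_smul {l : Type*} [Fintype l] [DecidableEq l] {R : symplecticGroup l ℤ}
    {i j : l} (hij : i ≠ j) (x : l ⊕ l → ℤ) :
    (R * κ i j * R⁻¹) • x = x - (2 * form x (R • b i) - form x (R • b j)) • R • a i
      - (2 * form (R • a i) x) • R • b i + form (R • a i) x • R • b j := by
  have h (y : l ⊕ l → ℤ) : form x (R • y) = form (R⁻¹ • x) y := by
    rw [form_smul_left_inv, inv_inv]
  have h' : form (R • a i) x = form (a i) (R⁻¹ • x) := form_smul_left_inv R _ x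
  rw [mul_smul, mul_smul, κ_smul hij, h (b i), h (b j), h']
  simp only [form_a, form_right_b, smul_sub, smul_add, smul_zsmul', smul_inv_smul]

theorem exists_three_involutions (hg : 8 ≤ g) :
    ∃ ρ : Fin 3 → symplecticGroup (Fin g) ℤ,
      Function.Injective ρ ∧ (∀ i, orderOf (ρ i) = 2) ∧
        Subgroup.closure (Set.range ρ) = ⊤ := by
  have : NeZero g := ⟨by lia⟩
  have h01 : 0 + 1 < g := by lia
  have h12 : 1 + 1 < g := by lia
  -- The pairs `3, 6` and their rotations `4, 7` are disjoint from each other and from `0, 1, 2`;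
  -- the index `7` is where `g ≥ 8` enters.
  let i₃ : Fin g := ⟨3, by lia⟩
  let i₆ : Fin g := ⟨6, by lia⟩
  have h36 : i₃ ≠ i₆ := by simp [i₃, i₆]
  have hc₁ : Commute (κ i₃ i₆) (perm (adj 0 h01)) :=
    commute_perm_κ h36 (Equiv.swap_apply_of_ne_of_ne (by simp [i₃]) (by simp [i₃]))
      (Equiv.swap_apply_of_ne_of_ne (by simp [i₆]) (by simp [i₆]))
  have hc₂ : Commute (κ i₃ i₆) (perm (adj 1 h12)) :=
    commute_perm_κ h36 (Equiv.swap_apply_of_ne_of_ne (by simp [i₃]) (by simp [i₃]))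
      (Equiv.swap_apply_of_ne_of_ne (by simp [i₆]) (by simp [i₆]))
  let ρ : Fin 3 → symplecticGroup (Fin g) ℤ :=
    ![tw refl₁, tw refl₂, perm (adj 0 h01) * κ i₃ i₆]
  have hsep : separator (show 2 ≤ g by lia) (perm (adj 0 h01) * κ i₃ i₆) = 1 := by
    rw [separator, mul_smul, κ_smul h36]
    simp [i₃, i₆, adj]
  have hord : orderOf (perm (adj 0 h01) * κ i₃ i₆) = 2 := by
    refine orderOf_eq_prime ?_ fun h => ?_
    · rw [hc₁.symm.mul_pow, pow_two, pow_two, κ_mul_self h36, mul_one, ← map_mul, adj,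
        Equiv.swap_mul_self, map_one]
    · rw [h, separator] at hsep
      simp at hsep
  refine ⟨ρ, ?_, ?_, ?_⟩
  · refine Function.Injective.of_comp (f := separator (show 2 ≤ g by lia)) ?_
    have : separator (show 2 ≤ g by lia) ∘ ρ = ![-1, 5, 1] := by
      ext i
      fin_cases i
      exacts [separator_tw_refl₁ _, separator_tw_refl₂ _, hsep]
    rw [this]
    decide
  · intro i
    fin_cases i
    exacts [orderOf_tw_refl₁ (by lia), orderOf_tw_refl₂ (by lia), hord]
  · have hρ (i) : ρ i ∈ Subgroup.closure (Set.range ρ) := Subgroup.subset_closure ⟨i, rfl⟩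
    generalize Subgroup.closure (Set.range ρ) = H at hρ
    have hR : tw rot ∈ H := rot_mem (hρ 0) (hρ 1)
    have h3 : perm (adj 0 h01) * κ i₃ i₆ ∈ H := hρ 2
    have hcyc : ∀ h : 0 + 2 < g, perm (adj 0 (by lia) * adj 1 h) ∈ H := fun h => by
      set R : symplecticGroup (Fin g) ℤ := tw rot with hRdef
      have hRs : R * perm (adj 0 h01) * R⁻¹ = perm (adj 1 h12) := by
        rw [conj_tw_rot_perm, conj_rot_adj (i := 0) h]
        rw [conj_rot_adj (i := 0) h, adj_apply_zero (i := 0) h]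
      have ha : R • a i₃ = a ⟨4, by lia⟩ - b ⟨4, by lia⟩ := tw_rot_smul_a (i := 3) (by lia)
      have hb₃ : R • b i₃ = a ⟨4, by lia⟩ := tw_rot_smul_b (i := 3) (by lia)
      have hb₆ : R • b i₆ = a ⟨7, by lia⟩ := tw_rot_smul_b (i := 6) (by lia)
      have hk (x : Fin g ⊕ Fin g → ℤ) := conj_κ_smul (R := R) h36 x
      simp only [ha, hb₃, hb₆] at hk
      have hc₃ : Commute (R * κ i₃ i₆ * R⁻¹) (perm (adj 0 h01)) := ext_smul fun x => by
        generalize R * κ i₃ i₆ * R⁻¹ = κ' at hk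
        rw [mul_smul, mul_smul, hk, hk]
        simp [smul_add, smul_sub, smul_zsmul', -zsmul_eq_mul, form_sub_left, adj, perm_smul_inl,
          perm_smul_inr, Equiv.swap_apply_of_ne_of_ne]
      have hc₅ : Commute (κ i₃ i₆) (R * κ i₃ i₆ * R⁻¹) := ext_smul fun x => by
        generalize R * κ i₃ i₆ * R⁻¹ = κ' at hk
        rw [mul_smul, mul_smul, hk, hk, κ_smul h36, κ_smul h36]
        simp [-zsmul_eq_mul, form_sub_left, i₃, i₆]
        module
      have hRρ : R * (perm (adj 0 h01) * κ i₃ i₆) * R⁻¹ =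
          perm (adj 1 h12) * (R * κ i₃ i₆ * R⁻¹) := by
        rw [← hRs]; group
      have hcomm : perm (adj 0 h01 * adj 1 h12 * (adj 0 h01)⁻¹ * (adj 1 h12)⁻¹) ∈ H := by
        simp only [map_mul, map_inv]
        rw [← commutator_mul_eq hc₂ hc₃ hc₅, ← hRρ]
        have h4 := mul_mem (mul_mem hR h3) (inv_mem hR)
        exact mul_mem (mul_mem (mul_mem h3 h4) (inv_mem h3)) (inv_mem h4)
      have hthree : (adj 0 h01 * adj 1 h12).IsThreeCycle := by
        rw [adj, adj, Equiv.swap_comm]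
        exact Equiv.Perm.isThreeCycle_swap_mul_swap_same (by simp) (by simp) (by simp)
      -- The commutator of two involutions is the square of their product, here a 3-cycle, and
      -- squaring again recovers the 3-cycle itself.
      have h5 : adj 0 h01 * adj 1 h12 =
          (adj 0 h01 * adj 1 h12 * (adj 0 h01)⁻¹ * (adj 1 h12)⁻¹) ^ 2 := by
        have h6 : adj 0 h01 * adj 1 h12 * (adj 0 h01)⁻¹ * (adj 1 h12)⁻¹ =
            (adj 0 h01 * adj 1 h12) ^ 2 := by
          simp only [adj, Equiv.swap_inv, pow_two, mul_assoc]
        have h7 := pow_orderOf_eq_one (adj 0 h01 * adj 1 h12)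
        rw [hthree.orderOf] at h7
        rw [h6, ← pow_mul, show 2 * 2 = 3 + 1 from rfl, pow_succ, h7, one_mul]
      rw [h5, map_pow]
      exact pow_mem hcomm 2
    have hA (σ : Equiv.Perm (Fin g)) (hσ : σ.sign = 1) : perm σ ∈ H :=
      mem_of_adj_mul_adj_mem (K := H.comap perm) (by lia) (perm_adj_mul_adj_mem hR hcyc) σ hσ
    refine eq_top_of_tw_rot (by lia) hR hA fun i j hij => ?_
    -- Multiplying the third generator by the even permutation `swap i₃ i₆ * adj 0` replaces its
    -- transposition by `swap i₃ i₆`.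
    have hK : perm (Equiv.swap i₃ i₆) * κ i₃ i₆ ∈ H := by
      have h4 := hA (Equiv.swap i₃ i₆ * adj 0 h01) (by
        rw [map_mul, sign_adj, Equiv.Perm.sign_swap h36]; rfl)
      have h5 := mul_mem h4 h3
      rwa [← mul_assoc, ← map_mul, mul_assoc (Equiv.swap i₃ i₆), adj, Equiv.swap_mul_self,
        mul_one] at h5
    obtain ⟨σ, hσ, rfl, rfl⟩ := exists_even_perm_apply_eq (p := (⟨0, by lia⟩ : Fin g))
      (q := ⟨1, by lia⟩) h36 hij (by simp) (by simp [i₃]) (by simp [i₃]) (by simp [i₆])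
      (by simp [i₆])
    have h6 := mul_mem (mul_mem (hA σ hσ) hK) (inv_mem (hA σ hσ))
    rw [← conj_perm_κ σ h36, Equiv.swap_apply_apply, map_mul, map_mul, map_inv]
    convert h6 using 1
    group

end Involutions

end SymplecticInt

theorem mainTheorem2 (g : ℕ) :
    (8 ≤ g → ∃ ρ : Fin 3 → Matrix.symplecticGroup (Fin g) ℤ,
      Function.Injective ρ ∧ (∀ i, orderOf (ρ i) = 2) ∧
        Subgroup.closure (Set.range ρ) = ⊤) ∧
    (3 ≤ g → ∃ ρ : Fin 4 → Matrix.symplecticGroup (Fin g) ℤ,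
      Function.Injective ρ ∧ (∀ i, orderOf (ρ i) = 2) ∧
        Subgroup.closure (Set.range ρ) = ⊤) :=
  ⟨SymplecticInt.exists_three_involutions, SymplecticInt.exists_four_involutions⟩
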